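/- Let $A$ be a finite alphabet, $\varphi:A^*\to A^*$ a morphism (possibly erasing) and $a\in A$ a letter such that $\varphi(a)$ begins with $a$ and $|\varphi^k(a)|\to\infty$; let $\alpha=\varphi^\infty(a)=\lim_k\varphi^k(a)$ be the infinite word having every $\varphi^k(a)$ as a prefix. A letter $x$ is called bounded for a morphism $\varphi$ if the sequence $(|\varphi^k(x)|)_{k\ge 0}$ is bounded, and growing otherwise; $\varphi$ is called growing if all letters are growing. Let $B\subseteq A$ be the set of bounded letters of $\varphi$. Suppose that $\varphi$ is not growing and that the factors of $\alpha$ that lie in $B^*$ have bounded length. Then there exist a finite alphabet $\Sigma$, a growing morphism $\sigma:\Sigma^*\to\Sigma^*$, a letter $b\in\Sigma$ such that $\sigma(b)$ begins with $b$ and $|\sigma^k(b)|\to\infty$, and a non-erasing morphism $\psi:\Sigma^*\to A^*$ such that $$\alpha=\psi(\sigma^\infty(b)),$$ and such that $\alpha$ and $\sigma^\infty(b)$ are in the same complexity class, i.e. $P_\alpha(n)=\Theta\big(P_{\sigma^\infty(b)}(n)\big)$ as $n\to\infty$, where $P_w(n)$ denotes the number of distinct factors of length $n$ of the infinite word $w$.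 Moreover $\Sigma$, $\sigma$, $b$, $\psi$ can be computed effectively and uniformly from $\varphi$ and $a$: there is a single algorithm (partial recursive function) which, given any such pair $(\varphi,a)$, with $A=\{0,\dots,n-1\}$ and $\varphi$ described by the list of the images of the letters, halts and outputs such a quadruple $(\Sigma,\sigma,b,\psi)$, with $\Sigma=\{0,\dots,m-1\}$ and $\sigma,\psi$ described in the same way. -/

import Mathlib

namespace PureMorphic

open Filter Asymptotics

/-! Finite words over an alphabet `A` are the elements of the free monoid `FreeMonoid A`, morphisms
are monoid homomorphisms between free monoids, and (right) infinite words are functions `ℕ → A`. -/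

/-- The factor `α_i α_{i+1} … α_{i+n-1}` of length `n` of the infinite word `α`. -/
def factorAt {A : Type*} (α : ℕ → A) (i n : ℕ) : FreeMonoid A :=
  FreeMonoid.ofList (List.ofFn fun j : Fin n => α (i + j))

/-- The finite word `w` is a factor of the infinite word `α`. -/
def IsFactor {A : Type*} (w : FreeMonoid A) (α : ℕ → A) : Prop :=
  ∃ i, w = factorAt α i w.length

/-- The finite word `w` is a prefix of the infinite word `α`. -/
def IsPrefixOf {A : Type*} (w : FreeMonoid A) (α : ℕ → A) : Prop :=
  w = factorAt α 0 w.length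

/-- The factor complexity `P_α`: the number of factors of `α` of each length. -/
noncomputable def complexity {A : Type*} (α : ℕ → A) (n : ℕ) : ℕ :=
  {w : FreeMonoid A | w.length = n ∧ IsFactor w α}.ncard

/-- Two infinite words (over possibly different alphabets) are in the same complexity class:
`P_α = Θ(P_β)`. -/
def SameComplexityClass {A B : Type*} (α : ℕ → A) (β : ℕ → B) : Prop :=
  (fun n => (complexity α n : ℝ)) =Θ[atTop] (fun n => (complexity β n : ℝ))

/-- The letter `a` is bounded for `φ`: the lengths `|φ^k(a)|` are bounded. -/
def IsBoundedLetter {A : Type*} (φ : FreeMonoid A →* FreeMonoid A) (a : A) : Prop :=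
  ∃ M : ℕ, ∀ k : ℕ, (φ^[k] (FreeMonoid.of a)).length ≤ M

/-- The morphism `φ` is growing: no letter is bounded. -/
def IsGrowing {A : Type*} (φ : FreeMonoid A →* FreeMonoid A) : Prop :=
  ∀ a : A, ¬ IsBoundedLetter φ a

/-- The morphism `ψ` is non-erasing: no letter is mapped to the empty word. -/
def IsNonErasing {A B : Type*} (ψ : FreeMonoid A →* FreeMonoid B) : Prop :=
  ∀ a : A, ψ (FreeMonoid.of a) ≠ 1

/-- The factors of `α` in `B^*` have bounded length, where `B` is the set of bounded letters
of `φ`. -/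
def BoundedFactorsBounded {A : Type*} (φ : FreeMonoid A →* FreeMonoid A) (α : ℕ → A) : Prop :=
  ∃ M : ℕ, ∀ w : FreeMonoid A, IsFactor w α →
    (∀ x ∈ w.toList, IsBoundedLetter φ x) → w.length ≤ M

/-- The infinite word `α` is the increasing limit of the finite words `w 0, w 1, …`: they are
prefixes of `α`, of lengths tending to infinity. Such an `α` is unique. -/
def IsLimitWord {A : Type*} (w : ℕ → FreeMonoid A) (α : ℕ → A) : Prop :=
  (∀ k, IsPrefixOf (w k) α) ∧ Tendsto (fun k => (w k).length) atTop atTop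

/-- `α = φ^∞(a)` is the pure morphic sequence generated by `φ` from the letter `a`: the word `φ(a)`
begins with `a`, and `α` is the (infinite) limit of the iterates `φ^k(a)`. -/
def IsPureMorphic {A : Type*} (φ : FreeMonoid A →* FreeMonoid A) (a : A) (α : ℕ → A) : Prop :=
  (∃ u, φ (FreeMonoid.of a) = FreeMonoid.of a * u) ∧
    IsLimitWord (fun k => φ^[k] (FreeMonoid.of a)) α

/-- `α = ψ(β)` for infinite words `α`, `β`. -/
def IsImage {A B : Type*} (ψ : FreeMonoid B →* FreeMonoid A) (β : ℕ → B) (α : ℕ → A) : Prop :=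
  IsLimitWord (fun k => ψ (factorAt β 0 k)) α

/-- The finite description of a morphism between free monoids on `{0, …, m-1}` and `{0, …, n-1}`:
the list of the images of the letters. -/
def code {m n : ℕ} (φ : FreeMonoid (Fin m) →* FreeMonoid (Fin n)) : List (List ℕ) :=
  List.ofFn fun i : Fin m => (φ (FreeMonoid.of i)).toList.map fun x : Fin n => (x : ℕ)

end PureMorphic

/-! Let M bound the runs of bounded letters in α. Some power Φ of φ maps every growing letter to at
least 3M+3 letters, and it still fixes α. Cutting α at the ends G(i) of the images of its prefixes
of length i could leave short or empty blocks for bounded letters. The cuts are therefore moved left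
to g(i) = G(i) − 2(M − r(i)), where r(i) ≤ M counts the letters since the last growing one. A
growing letter gives up at most 2M letters of its long image, and each bounded letter after it gains
two, so every block has length at least 2.

The block from g(i) to g(i+1) depends only on the window of M+2 letters of α ending at i. Coding
positions by these windows (and the first M+1 positions by themselves) turns the cutting into a
morphism σ with all images of length at least 2, hence growing
(`exists_isCertificate_of_bounded_gaps`). The map ψ sends a code to the letter at its position. A
code is determined by the preceding code and the new letter, so the two complexities differ by at
most a constant factor (`complexity_le_card_mul`).

For effectivity, the construction is summarised by finitely many checkable identities
(`IsCertificate`), and any data satisfying them give the conclusion (`IsCertificate.sound`). An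
unbounded search thus suffices, and the bounded letters, M and the exponent never have to be
computed. -/

namespace PureMorphic

open Filter Asymptotics

/-! ### Factors, prefixes, iterates and complexity of infinite words -/

section Words

variable {A B : Type*}

@[simp] theorem length_factorAt (α : ℕ → A) (i n : ℕ) : (factorAt α i n).length = n := by
  simp [factorAt, FreeMonoid.length]

theorem toList_factorAt (α : ℕ → A) (i n : ℕ) :
    (factorAt α i n).toList = List.ofFn fun j : Fin n => α (i + j) := rfl

@[simp] theorem factorAt_zero (α : ℕ → A) (i : ℕ) : factorAt α i 0 = 1 := rfl

@[simp] theorem factorAt_one (α : ℕ → A) (i : ℕ) : factorAt α i 1 = FreeMonoid.of (α i) := rfl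

theorem factorAt_add (α : ℕ → A) (i m n : ℕ) :
    factorAt α i (m + n) = factorAt α i m * factorAt α (i + m) n := by
  apply FreeMonoid.toList.injective
  simp [toList_factorAt, List.ofFn_add, Nat.add_assoc]

theorem factorAt_succ (α : ℕ → A) (i n : ℕ) :
    factorAt α i (n + 1) = factorAt α i n * FreeMonoid.of (α (i + n)) := by
  rw [factorAt_add, factorAt_one]

theorem factorAt_eq_factorAt_iff {α γ : ℕ → A} {i j n : ℕ} :
    factorAt α i n = factorAt γ j n ↔ ∀ k < n, α (i + k) = γ (j + k) := by
  rw [← FreeMonoid.toList.injective.eq_iff, toList_factorAt, toList_factorAt, List.ofFn_inj,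
    funext_iff]
  exact ⟨fun h k hk => h ⟨k, hk⟩, fun h k => h k k.2⟩

theorem map_factorAt (f : A → B) (α : ℕ → A) (i n : ℕ) :
    FreeMonoid.map f (factorAt α i n) = factorAt (fun k => f (α k)) i n := by
  apply FreeMonoid.toList.injective
  simp [toList_factorAt, FreeMonoid.toList_map, List.map_ofFn, Function.comp_def]

@[simp] theorem length_map (f : A → B) (w : FreeMonoid A) :
    (FreeMonoid.map f w).length = w.length := by
  simp [FreeMonoid.length, FreeMonoid.toList_map]

theorem mul_eq_factorAt {α : ℕ → A} {i n : ℕ} {u v : FreeMonoid A} (h : u * v = factorAt α i n) :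
    u = factorAt α i u.length ∧ v = factorAt α (i + u.length) v.length := by
  have hn : n = u.length + v.length := by
    rw [← FreeMonoid.length_mul, h, length_factorAt]
  subst hn
  rw [factorAt_add] at h
  have h' := congrArg FreeMonoid.toList h
  rw [FreeMonoid.toList_mul, FreeMonoid.toList_mul] at h'
  obtain ⟨h1, h2⟩ := List.append_inj h' (length_factorAt α i u.length).symm
  exact ⟨FreeMonoid.toList.injective h1, FreeMonoid.toList.injective h2⟩

theorem isPrefixOf_factorAt (α : ℕ → A) (n : ℕ) : IsPrefixOf (factorAt α 0 n) α := by
  simp [IsPrefixOf]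

theorem IsPrefixOf.left {α : ℕ → A} {u v : FreeMonoid A} (h : IsPrefixOf (u * v) α) :
    IsPrefixOf u α :=
  (mul_eq_factorAt h).1

theorem IsPrefixOf.exists_mul_eq {α : ℕ → A} {u v : FreeMonoid A} (hu : IsPrefixOf u α)
    (hv : IsPrefixOf v α) (h : u.length ≤ v.length) : ∃ s, v = u * s := by
  obtain ⟨k, hk⟩ := Nat.exists_eq_add_of_le h
  refine ⟨factorAt α (0 + u.length) k, ?_⟩
  conv_rhs => rw [hu]
  rw [hv, hk, length_factorAt, ← factorAt_add]

theorem iterate_mul (φ : FreeMonoid A →* FreeMonoid A) (k : ℕ) (u v : FreeMonoid A) :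
    φ^[k] (u * v) = φ^[k] u * φ^[k] v :=
  iterate_map_mul φ k u v

/-- A prefix of α is a prefix of some φ^k(a), so its image is a prefix of φ^(k+1)(a). -/
theorem IsPureMorphic.isPrefixOf_map {φ : FreeMonoid A →* FreeMonoid A} {a : A} {α : ℕ → A}
    (h : IsPureMorphic φ a α) {w : FreeMonoid A} (hw : IsPrefixOf w α) : IsPrefixOf (φ w) α := by
  obtain ⟨k, hk⟩ := (h.2.2.eventually_ge_atTop w.length).exists
  obtain ⟨s, hs⟩ := hw.exists_mul_eq (h.2.1 k) hk
  have := h.2.1 (k + 1)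
  simp only [Function.iterate_succ', Function.comp_apply] at this
  dsimp only at hs
  rw [hs, map_mul] at this
  exact this.left

theorem IsPureMorphic.isPrefixOf_iterate {φ : FreeMonoid A →* FreeMonoid A} {a : A} {α : ℕ → A}
    (h : IsPureMorphic φ a α) (p : ℕ) {w : FreeMonoid A} (hw : IsPrefixOf w α) :
    IsPrefixOf (φ^[p] w) α := by
  induction p with
  | zero => exact hw
  | succ p ih =>
    rw [Function.iterate_succ', Function.comp_apply]
    exact h.isPrefixOf_map ih

theorem IsPureMorphic.apply_zero {φ : FreeMonoid A →* FreeMonoid A} {a : A} {α : ℕ → A}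
    (h : IsPureMorphic φ a α) : α 0 = a := by
  have := h.2.1 0
  simp only [IsPrefixOf, Function.iterate_zero, id, FreeMonoid.length_of, factorAt_one] at this
  exact (FreeMonoid.of_injective this).symm

/-- A sequence of words, each a prefix of the next one, with unbounded lengths, has a limit. -/
theorem exists_isLimitWord {w : ℕ → FreeMonoid A} (hw : ∀ k, ∃ s, w (k + 1) = w k * s)
    (hl : Tendsto (fun k => (w k).length) atTop atTop) : ∃ α : ℕ → A, IsLimitWord w α := by
  have hmono : ∀ k l, k ≤ l → (w k).toList <+: (w l).toList := by
    intro k l hkl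
    induction hkl with
    | refl => exact List.prefix_refl _
    | step _ ih =>
      obtain ⟨s, hs⟩ := hw _
      refine ih.trans ?_
      rw [Nat.succ_eq_add_one, hs, FreeMonoid.toList_mul]
      exact List.prefix_append _ _
  have hex : ∀ i, ∃ k, i < (w k).toList.length := fun i => (hl.eventually_gt_atTop i).exists
  choose N hN using hex
  refine ⟨fun i => (w (N i)).toList[i]'(hN i), fun k => ?_, hl⟩
  apply FreeMonoid.toList.injective
  apply List.ext_getElem
  · simp [toList_factorAt, FreeMonoid.length]
  · intro i h1 h2
    simp only [toList_factorAt, List.getElem_ofFn, Nat.zero_add]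
    rcases le_total k (N i) with h | h
    · exact (hmono _ _ h).getElem h1
    · exact ((hmono _ _ h).getElem (hN i)).symm

theorem length_le_length_map {φ : FreeMonoid A →* FreeMonoid B} {c : ℕ}
    (h : ∀ x, c ≤ (φ (FreeMonoid.of x)).length) (w : FreeMonoid A) :
    c * w.length ≤ (φ w).length := by
  induction w using FreeMonoid.inductionOn' with
  | one => simp
  | of_mul x w ih =>
    rw [map_mul, FreeMonoid.length_mul, FreeMonoid.length_mul, FreeMonoid.length_of, Nat.mul_add]
    have := h x
    omega

theorem two_pow_le_length_iterate {σ : FreeMonoid A →* FreeMonoid A}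
    (h : ∀ x, 2 ≤ (σ (FreeMonoid.of x)).length) (x : A) (k : ℕ) :
    2 ^ k ≤ (σ^[k] (FreeMonoid.of x)).length := by
  induction k with
  | zero => simp
  | succ k ih =>
    rw [Function.iterate_succ', Function.comp_apply, pow_succ']
    exact (Nat.mul_le_mul_left 2 ih).trans (length_le_length_map h _)

theorem tendsto_length_iterate {σ : FreeMonoid A →* FreeMonoid A}
    (h : ∀ x, 2 ≤ (σ (FreeMonoid.of x)).length) (x : A) :
    Tendsto (fun k => (σ^[k] (FreeMonoid.of x)).length) atTop atTop :=
  tendsto_atTop_mono (two_pow_le_length_iterate h x)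
    (tendsto_pow_atTop_atTop_of_one_lt one_lt_two)

theorem isGrowing_of_two_le {σ : FreeMonoid A →* FreeMonoid A}
    (h : ∀ x, 2 ≤ (σ (FreeMonoid.of x)).length) : IsGrowing σ := by
  rintro x ⟨M, hM⟩
  obtain ⟨k, hk⟩ := ((tendsto_length_iterate h x).eventually_gt_atTop M).exists
  exact absurd (hM k) (not_le.2 hk)

/-- As no image is empty, every junction of blocks in σ(w) already occurs in σ(xy) for two
consecutive letters x, y of w. -/
theorem isChain_map {T : A → A → Prop} {σ : FreeMonoid A →* FreeMonoid A}
    (hne : ∀ x, σ (FreeMonoid.of x) ≠ 1)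
    (h1 : ∀ x, List.IsChain T (σ (FreeMonoid.of x)).toList)
    (h2 : ∀ x y, T x y → List.IsChain T (σ (FreeMonoid.of x * FreeMonoid.of y)).toList)
    (w : FreeMonoid A) (hw : List.IsChain T w.toList) : List.IsChain T (σ w).toList := by
  induction w using FreeMonoid.inductionOn' with
  | one => simp
  | of_mul x w ih =>
    rw [map_mul, FreeMonoid.toList_mul, List.isChain_append]
    rw [FreeMonoid.toList_of_mul] at hw
    refine ⟨h1 x, ih hw.tail, ?_⟩
    cases w using FreeMonoid.casesOn with
    | one => simp
    | of_mul y w =>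
      intro p hp q hq
      have hxy : T x y := by
        rw [FreeMonoid.toList_of_mul, List.isChain_cons_cons] at hw
        exact hw.1
      have := h2 x y hxy
      rw [map_mul, FreeMonoid.toList_mul, List.isChain_append] at this
      refine this.2.2 p hp q ?_
      rw [map_mul, FreeMonoid.toList_mul, List.head?_append_of_ne_nil] at hq
      · exact hq
      · exact fun h => hne y (FreeMonoid.toList.injective h)

theorem finite_factors [Finite A] (α : ℕ → A) (n : ℕ) :
    {w : FreeMonoid A | w.length = n ∧ IsFactor w α}.Finite :=
  (List.finite_length_eq A n).subset fun _ hw => hw.1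

theorem factors_eq_range (α : ℕ → A) (n : ℕ) :
    {w : FreeMonoid A | w.length = n ∧ IsFactor w α} = Set.range fun i => factorAt α i n := by
  ext w
  constructor
  · rintro ⟨rfl, i, hi⟩
    exact ⟨i, hi.symm⟩
  · rintro ⟨i, rfl⟩
    exact ⟨length_factorAt _ _ _, i, by rw [length_factorAt]⟩

theorem complexity_map_le [Finite A] (f : A → B) (α : ℕ → A) (n : ℕ) :
    complexity (fun k => f (α k)) n ≤ complexity α n := by
  have hfin := finite_factors α n
  unfold complexity
  rw [factors_eq_range] at hfin ⊢
  have : (Set.range fun i => factorAt (fun k => f (α k)) i n) =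
      FreeMonoid.map f '' Set.range fun i => factorAt α i n := by
    rw [← Set.range_comp]
    simp only [Function.comp_def, map_factorAt]
  rw [factors_eq_range, this]
  exact Set.ncard_image_le hfin

/-- If every letter of `β` is determined by the previous one and by its image under `f`, then
the factors of `β` are determined by their first letters and their images. -/
theorem complexity_le_card_mul [Finite A] [Finite B] {f : B → A} {β : ℕ → B}
    (hdet : ∀ i j, β i = β j → f (β (i + 1)) = f (β (j + 1)) → β (i + 1) = β (j + 1)) (n : ℕ) :
    complexity β n ≤ Nat.card B * complexity (fun k => f (β k)) n := by
  have hkey : ∀ i j, β i = β j →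
      factorAt (fun k => f (β k)) i n = factorAt (fun k => f (β k)) j n →
      factorAt β i n = factorAt β j n := by
    intro i j h0 h
    rw [factorAt_eq_factorAt_iff] at h ⊢
    intro k hk
    induction k with
    | zero => simpa using h0
    | succ k ih => exact hdet _ _ (ih (by omega)) (h (k + 1) hk)
  have hfin := finite_factors (fun k => f (β k)) n
  unfold complexity
  rw [factors_eq_range] at hfin ⊢
  rw [factors_eq_range, ← Set.ncard_univ, ← Set.ncard_prod]
  -- `g w` is the start of one occurrence of `w`; the letter of `β` there and the projected factor
  -- identify `w`.
  choose! g hg using fun w (hw : w ∈ Set.range fun i => factorAt β i n) => hw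
  simp only at hg
  refine Set.ncard_le_ncard_of_injOn
    (fun w => (β (g w), factorAt (fun k => f (β k)) (g w) n)) ?_ ?_ (Set.finite_univ.prod hfin)
  · intro w _
    exact ⟨trivial, _, rfl⟩
  · intro u hu v hv huv
    rw [← hg u hu, ← hg v hv]
    exact hkey _ _ (congrArg Prod.fst huv) (congrArg Prod.snd huv)

end Words

/-! ### Certificates and their soundness -/

section Certificate

variable {A S : Type*}

/-- A finite certificate for the fact that the fixed point of `σ` starting with `b` is mapped by the
coding `π` to the fixed point of `Φ` starting with `a`. The word `t x` is the part of the image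
under `Φ` by which the image under `σ` lags behind, and `T` contains the pairs of consecutive
letters. -/
structure IsCertificate (Φ : FreeMonoid A →* FreeMonoid A) (a : A)
    (σ : FreeMonoid S →* FreeMonoid S) (b : S) (π : S → A) (t : S → FreeMonoid A)
    (T : S → S → Prop) : Prop where
  head : ∃ u, σ (FreeMonoid.of b) = FreeMonoid.of b * u
  two_le : ∀ x, 2 ≤ (σ (FreeMonoid.of x)).length
  letter : π b = a
  lag : t b = 1
  chain : ∀ x, List.IsChain T (σ (FreeMonoid.of x)).toList
  chain_mul : ∀ x y, T x y → List.IsChain T (σ (FreeMonoid.of x * FreeMonoid.of y)).toList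
  conj : ∀ x y, T x y →
    FreeMonoid.map π (σ (FreeMonoid.of x)) * t y = t x * Φ (FreeMonoid.of (π x))
  det : ∀ x y z, T x y → T x z → π y = π z → y = z

namespace IsCertificate

variable {Φ : FreeMonoid A →* FreeMonoid A} {a : A} {σ : FreeMonoid S →* FreeMonoid S} {b : S}
  {π : S → A} {t : S → FreeMonoid A} {T : S → S → Prop}

theorem exists_isPureMorphic (h : IsCertificate Φ a σ b π t T) :
    ∃ β : ℕ → S, IsPureMorphic σ b β := by
  obtain ⟨u, hu⟩ := h.head
  obtain ⟨β, hβ⟩ := exists_isLimitWord (w := fun k => σ^[k] (FreeMonoid.of b))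
    (fun k => ⟨σ^[k] u, by rw [Function.iterate_succ_apply, hu, iterate_mul]⟩)
    (tendsto_length_iterate h.two_le b)
  exact ⟨β, ⟨u, hu⟩, hβ⟩

theorem rel_succ (h : IsCertificate Φ a σ b π t T) {β : ℕ → S} (hβ : IsPureMorphic σ b β) (i : ℕ) :
    T (β i) (β (i + 1)) := by
  have hc : ∀ k, List.IsChain T (σ^[k] (FreeMonoid.of b)).toList := by
    intro k
    induction k with
    | zero => simp
    | succ k ih =>
      rw [Function.iterate_succ', Function.comp_apply]
      refine isChain_map (fun x hx => ?_) h.chain h.chain_mul _ ih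
      simpa [hx] using h.two_le x
  obtain ⟨k, hk⟩ := (hβ.2.2.eventually_gt_atTop (i + 1)).exists
  have := hc k
  have hp : IsPrefixOf (σ^[k] (FreeMonoid.of b)) β := hβ.2.1 k
  rw [hp, List.isChain_iff_getElem] at this
  simpa [toList_factorAt] using this i (by simpa [toList_factorAt] using hk)

/-- The lags telescope: `conj` trades the lag before each letter for the lag after it, and the first
lag is empty. -/
theorem map_mul_lag (h : IsCertificate Φ a σ b π t T) {β : ℕ → S} (hβ : IsPureMorphic σ b β)
    (k : ℕ) : FreeMonoid.map π (σ (factorAt β 0 k)) * t (β k) =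
      Φ (FreeMonoid.map π (factorAt β 0 k)) := by
  induction k with
  | zero => simp [hβ.apply_zero, h.lag]
  | succ k ih =>
    rw [factorAt_succ, map_mul, map_mul, map_mul, map_mul, ← ih, mul_assoc, Nat.zero_add,
      h.conj _ _ (h.rel_succ hβ k), FreeMonoid.map_of, mul_assoc]

theorem map_eq (h : IsCertificate Φ a σ b π t T) {β : ℕ → S} (hβ : IsPureMorphic σ b β)
    {α : ℕ → A} (hα : α 0 = a) (hΦ : ∀ w, IsPrefixOf w α → IsPrefixOf (Φ w) α) (i : ℕ) :
    π (β i) = α i := by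
  -- Agreement on k letters spreads to 2k: the projected σ-image is a prefix of a Φ-image, hence of
  -- α, and σ at least doubles lengths.
  have step : ∀ k, (∀ i < k, π (β i) = α i) → ∀ i < 2 * k, π (β i) = α i := by
    intro k hk i hi
    have h1 : FreeMonoid.map π (factorAt β 0 k) = factorAt α 0 k := by
      rw [map_factorAt, factorAt_eq_factorAt_iff]
      simpa using hk
    have h2 := hΦ _ (isPrefixOf_factorAt α k)
    rw [← h1, ← h.map_mul_lag hβ] at h2
    have h3 := h2.left
    have h4 := hβ.isPrefixOf_map (isPrefixOf_factorAt β k)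
    have h5 : 2 * k ≤ (σ (factorAt β 0 k)).length := by
      simpa using length_le_length_map h.two_le (factorAt β 0 k)
    rw [h4, map_factorAt, IsPrefixOf, length_factorAt, factorAt_eq_factorAt_iff] at h3
    simpa using h3 i (by omega)
  have hpow : ∀ n, ∀ i < 2 ^ n, π (β i) = α i := by
    intro n
    induction n with
    | zero =>
      intro i hi
      obtain rfl : i = 0 := by simpa using hi
      rw [hβ.apply_zero, h.letter, hα]
    | succ n ih =>
      rw [pow_succ']
      exact step _ ih
  exact hpow i i Nat.lt_two_pow_self

/-- The assumption on Φ holds for every power of φ, so the exponent in a certificate may be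
arbitrary. -/
theorem sound [Finite A] [Finite S] (h : IsCertificate Φ a σ b π t T)
    {α : ℕ → A} (hα : α 0 = a) (hΦ : ∀ w, IsPrefixOf w α → IsPrefixOf (Φ w) α) :
    IsGrowing σ ∧ ∃ β : ℕ → S, IsPureMorphic σ b β ∧ IsImage (FreeMonoid.map π) β α ∧
      SameComplexityClass α β := by
  obtain ⟨β, hβ⟩ := h.exists_isPureMorphic
  obtain rfl : (fun k => π (β k)) = α := funext (h.map_eq hβ hα hΦ)
  refine ⟨isGrowing_of_two_le h.two_le, β, hβ, ⟨fun k => ?_, ?_⟩, ?_, ?_⟩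
  · simp only [map_factorAt]
    exact isPrefixOf_factorAt _ _
  · simp only [length_map, length_factorAt]
    exact tendsto_id
  · refine IsBigO.of_bound 1 (Eventually.of_forall fun n => ?_)
    simpa using complexity_map_le π β n
  · refine IsBigO.of_bound (Nat.card S) (Eventually.of_forall fun n => ?_)
    simp only [Real.norm_natCast]
    exact_mod_cast complexity_le_card_mul (fun i j hij hf =>
      h.det _ _ _ (h.rel_succ hβ i) (hij ▸ h.rel_succ hβ j) hf) n

end IsCertificate

end Certificate

/-! ### Bounded and growing letters -/

section Growth

variable {A : Type*}

theorem isBoundedLetter_of_iterate_eq {φ : FreeMonoid A →* FreeMonoid A} {c : A} {k l : ℕ}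
    (hkl : k < l) (h : φ^[k] (FreeMonoid.of c) = φ^[l] (FreeMonoid.of c)) :
    IsBoundedLetter φ c := by
  refine ⟨∑ i ∈ Finset.range l, (φ^[i] (FreeMonoid.of c)).length, fun n => ?_⟩
  induction n using Nat.strong_induction_on with
  | _ n ih =>
    rcases lt_or_ge n l with hn | hn
    · exact Finset.single_le_sum (f := fun i => (φ^[i] (FreeMonoid.of c)).length)
        (fun _ _ => Nat.zero_le _) (Finset.mem_range.2 hn)
    · obtain ⟨d, rfl⟩ := Nat.exists_eq_add_of_le' hn
      rw [Function.iterate_add_apply, ← h, ← Function.iterate_add_apply]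
      exact ih _ (by omega)

/-- Pigeonhole: there are finitely many words shorter than N, so infinitely many short iterates
would include two equal ones, making the orbit eventually periodic and the letter bounded. -/
theorem eventually_le_length_iterate [Finite A] {φ : FreeMonoid A →* FreeMonoid A} {c : A}
    (hc : ¬ IsBoundedLetter φ c) (N : ℕ) :
    ∀ᶠ k in atTop, N ≤ (φ^[k] (FreeMonoid.of c)).length := by
  by_contra hcon
  have hinf : {k | ¬ N ≤ (φ^[k] (FreeMonoid.of c)).length}.Infinite :=
    Nat.frequently_atTop_iff_infinite.1 (not_eventually.1 hcon)
  obtain ⟨k, -, l, -, hne, heq⟩ := hinf.exists_ne_map_eq_of_mapsTo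
    (f := fun k => φ^[k] (FreeMonoid.of c)) (t := {w : FreeMonoid A | w.length < N})
    (fun k hk => not_le.1 hk) (List.finite_length_lt A N)
  rcases lt_or_gt_of_ne hne with h | h
  · exact hc (isBoundedLetter_of_iterate_eq h heq)
  · exact hc (isBoundedLetter_of_iterate_eq h heq.symm)

theorem exists_forall_le_length_iterate [Finite A] (φ : FreeMonoid A →* FreeMonoid A) (N : ℕ) :
    ∃ p, ∀ c, ¬ IsBoundedLetter φ c → N ≤ (φ^[p] (FreeMonoid.of c)).length := by
  refine (eventually_all.2 fun c => ?_ :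
    ∀ᶠ p in atTop, ∀ c, ¬ IsBoundedLetter φ c → N ≤ (φ^[p] (FreeMonoid.of c)).length).exists
  by_cases hc : IsBoundedLetter φ c
  · exact Eventually.of_forall fun _ h => absurd hc h
  · exact (eventually_le_length_iterate hc N).mono fun _ h _ => h

theorem IsPureMorphic.not_isBoundedLetter {φ : FreeMonoid A →* FreeMonoid A} {a : A} {α : ℕ → A}
    (h : IsPureMorphic φ a α) : ¬ IsBoundedLetter φ a := by
  rintro ⟨M, hM⟩
  obtain ⟨k, hk⟩ := (h.2.2.eventually_gt_atTop M).exists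
  exact absurd (hM k) (not_le.2 hk)

theorem BoundedFactorsBounded.exists_le {φ : FreeMonoid A →* FreeMonoid A} {α : ℕ → A}
    (h : BoundedFactorsBounded φ α) :
    ∃ M, ∀ i n, (∀ k < n, IsBoundedLetter φ (α (i + k))) → n ≤ M := by
  obtain ⟨M, hM⟩ := h
  refine ⟨M, fun i n hn => ?_⟩
  have := hM (factorAt α i n) ⟨i, by rw [length_factorAt]⟩ (fun x hx => ?_)
  · rwa [length_factorAt] at this
  · rw [toList_factorAt, List.mem_ofFn] at hx
    obtain ⟨k, rfl⟩ := hx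
    exact hn k k.2

end Growth

/-! ### From cutting points to a certificate -/

section Cut

variable {A S : Type*}

theorem map_factorAt_of_isPrefixOf {α : ℕ → A} {Φ : FreeMonoid A →* FreeMonoid A}
    (hΦ : ∀ w, IsPrefixOf w α → IsPrefixOf (Φ w) α) (i n : ℕ) :
    Φ (factorAt α i n) =
      factorAt α (Φ (factorAt α 0 i)).length (Φ (factorAt α i n)).length := by
  have h := hΦ _ (isPrefixOf_factorAt α (i + n))
  rw [factorAt_add, map_mul, Nat.zero_add] at h
  simpa using (mul_eq_factorAt h).2

theorem isChain_factorAt {T : S → S → Prop} {β : ℕ → S} (h : ∀ i, T (β i) (β (i + 1)))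
    (i n : ℕ) : List.IsChain T (factorAt β i n).toList := by
  rw [List.isChain_iff_getElem]
  intro k hk
  simpa [toList_factorAt, Nat.add_assoc] using h (i + k)

theorem factorAt_mul_factorAt {α : ℕ → A} {i j k : ℕ} (hij : i ≤ j) (hjk : j ≤ k) :
    factorAt α i (j - i) * factorAt α j (k - j) = factorAt α i (k - i) := by
  rw [show k - i = (j - i) + (k - j) by omega, factorAt_add, Nat.add_sub_cancel' hij]

/-- A coding `β` of the positions of a fixed point `α` of `Φ`, together with cutting points `g i`
lagging behind the images under `Φ` of the prefixes of `α`, yields a certificate as soon as the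
segments between consecutive cutting points only depend on the code of the position. -/
theorem exists_isCertificate_of_cut {α : ℕ → A} {Φ : FreeMonoid A →* FreeMonoid A}
    (hΦ : ∀ w, IsPrefixOf w α → IsPrefixOf (Φ w) α) {β : ℕ → S} (hβ : Function.Surjective β)
    {G g : ℕ → ℕ} (hG : ∀ i, G i = (Φ (factorAt α 0 i)).length) (hgG : ∀ i, g i ≤ G i)
    (hg0 : g 0 = 0) (hg : ∀ i, g i + 2 ≤ g (i + 1)) (hletter : ∀ i j, β i = β j → α i = α j)
    (hdet : ∀ i j, β i = β j → α (i + 1) = α (j + 1) → β (i + 1) = β (j + 1))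
    (himage : ∀ i j, β i = β j →
      factorAt β (g i) (g (i + 1) - g i) = factorAt β (g j) (g (j + 1) - g j))
    (hlag : ∀ i j, β i = β j → factorAt α (g i) (G i - g i) = factorAt α (g j) (G j - g j)) :
    ∃ (σ : FreeMonoid S →* FreeMonoid S) (π : S → A) (t : S → FreeMonoid A) (T : S → S → Prop),
      IsCertificate Φ (α 0) σ (β 0) π t T := by
  -- `s` picks a position for each code; `himage`, `hletter` and `hlag` make σ, π and t independent
  -- of this choice.
  choose s hs using hβ
  let σ : FreeMonoid S →* FreeMonoid S :=
    FreeMonoid.lift fun x => factorAt β (g (s x)) (g (s x + 1) - g (s x))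
  let π : S → A := fun x => α (s x)
  let t : S → FreeMonoid A := fun x => factorAt α (g (s x)) (G (s x) - g (s x))
  have hσ : ∀ i, σ (FreeMonoid.of (β i)) = factorAt β (g i) (g (i + 1) - g i) := fun i =>
    himage _ _ (hs (β i))
  have hπ : ∀ i, π (β i) = α i := fun i => hletter _ _ (hs (β i))
  have ht : ∀ i, t (β i) = factorAt α (g i) (G i - g i) := fun i => hlag _ _ (hs (β i))
  have hG0 : G 0 = 0 := by simp [hG]
  have hGs : ∀ i, G i ≤ G (i + 1) := fun i => by
    rw [hG, hG, factorAt_succ, map_mul, FreeMonoid.length_mul]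
    exact Nat.le_add_right _ _
  have hrel : ∀ i, ∃ j, β i = β j ∧ β (i + 1) = β (j + 1) := fun i => ⟨i, rfl, rfl⟩
  refine ⟨σ, π, t, fun x y => ∃ i, x = β i ∧ y = β (i + 1), ?_, ?_, hπ 0, ?_, ?_, ?_, ?_, ?_⟩
  · refine ⟨factorAt β 1 (g 1 - 1), ?_⟩
    have : g 0 + 2 ≤ g 1 := hg 0
    rw [hσ, hg0, Nat.sub_zero, Nat.zero_add, ← factorAt_one,
      show g 1 = 1 + (g 1 - 1) by omega, factorAt_add, Nat.zero_add, Nat.add_sub_cancel_left]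
  · intro x
    rw [← hs x, hσ, length_factorAt]
    have := hg (s x)
    omega
  · rw [ht, hG0, Nat.zero_sub, factorAt_zero]
  · intro x
    rw [← hs x, hσ]
    exact isChain_factorAt hrel _ _
  · rintro _ _ ⟨i, rfl, rfl⟩
    have h1 := hg i
    have h2 := hg (i + 1)
    rw [map_mul, hσ, hσ, factorAt_mul_factorAt (by omega) (by omega)]
    exact isChain_factorAt hrel _ _
  -- Both sides of `conj` spell the factor of α from `g i` to `G (i + 1)`, split at `g (i + 1)` or
  -- at `G i`.
  · rintro _ _ ⟨i, rfl, rfl⟩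
    have h1 := hg i
    have h2 : Φ (FreeMonoid.of (α i)) = factorAt α (G i) (G (i + 1) - G i) := by
      rw [← factorAt_one, map_factorAt_of_isPrefixOf hΦ, hG, hG, factorAt_add, map_mul,
        FreeMonoid.length_mul, Nat.add_sub_cancel_left, Nat.zero_add]
    rw [hσ, hπ, ht, ht, h2, map_factorAt, funext hπ,
      factorAt_mul_factorAt (by omega) (hgG _), factorAt_mul_factorAt (hgG _) (hGs _)]
  · rintro x y z ⟨i, rfl, rfl⟩ ⟨j, hij, rfl⟩ h
    rw [hπ, hπ] at h
    exact hdet i j hij h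

end Cut

/-! ### Gaps, windows and the choice of the cuts -/

section Window

variable {A : Type*}

open Classical in
/-- The number of letters between the position `i` and the last earlier position whose letter
satisfies `P`; it is `M` for `i = 0`. -/
noncomputable def gap (P : A → Prop) (α : ℕ → A) (M : ℕ) : ℕ → ℕ
  | 0 => M
  | i + 1 => if P (α i) then 0 else gap P α M i + 1

theorem gap_succ_of_pos {P : A → Prop} {α : ℕ → A} (M : ℕ) {i : ℕ} (h : P (α i)) :
    gap P α M (i + 1) = 0 := by simp [gap, h]

theorem gap_succ_of_neg {P : A → Prop} {α : ℕ → A} (M : ℕ) {i : ℕ} (h : ¬ P (α i)) :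
    gap P α M (i + 1) = gap P α M i + 1 := by simp [gap, h]

theorem gap_spec {P : A → Prop} {α : ℕ → A} (h0 : P (α 0)) (M i : ℕ) :
    gap P α M (i + 1) ≤ i ∧ P (α (i - gap P α M (i + 1))) ∧
      ∀ k < gap P α M (i + 1), ¬ P (α (i - k)) := by
  induction i with
  | zero => simp [gap_succ_of_pos M h0, h0]
  | succ i ih =>
    by_cases h : P (α (i + 1))
    · simp [gap_succ_of_pos M h, h]
    · rw [gap_succ_of_neg M h]
      refine ⟨by omega, ?_, fun k hk => ?_⟩
      · rw [Nat.add_sub_add_right]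
        exact ih.2.1
      · rcases k with _ | k
        · exact h
        · rw [Nat.add_sub_add_right]
          exact ih.2.2 k (by omega)

theorem gap_le {P : A → Prop} {α : ℕ → A} (h0 : P (α 0)) {M : ℕ}
    (hM : ∀ i n, (∀ k < n, ¬ P (α (i + k))) → n ≤ M) (i : ℕ) : gap P α M i ≤ M := by
  rcases i with _ | i
  · exact le_rfl
  · obtain ⟨h1, -, h3⟩ := gap_spec h0 M i
    refine hM (i + 1 - gap P α M (i + 1)) _ fun k hk => ?_
    have := h3 (gap P α M (i + 1) - 1 - k) (by omega)
    rwa [show i - (gap P α M (i + 1) - 1 - k) = i + 1 - gap P α M (i + 1) + k by omega] at this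

/-- The windows of length `R + 1` ending at the positions `i` and `j` exist and agree. -/
def WindowEq (α : ℕ → A) (R i j : ℕ) : Prop :=
  R ≤ i ∧ R ≤ j ∧ ∀ k ≤ R, α (i - k) = α (j - k)

theorem WindowEq.symm {α : ℕ → A} {R i j : ℕ} (h : WindowEq α R i j) : WindowEq α R j i :=
  ⟨h.2.1, h.1, fun k hk => (h.2.2 k hk).symm⟩

theorem WindowEq.succ {α : ℕ → A} {R i j : ℕ} (h : WindowEq α R i j)
    (h1 : α (i + 1) = α (j + 1)) : WindowEq α R (i + 1) (j + 1) := by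
  refine ⟨by have := h.1; omega, by have := h.2.1; omega, fun k hk => ?_⟩
  rcases k with _ | k
  · exact h1
  · rw [Nat.add_sub_add_right, Nat.add_sub_add_right]
    exact h.2.2 k (by omega)

theorem WindowEq.factorAt_eq {α : ℕ → A} {R i j : ℕ} (h : WindowEq α R i j) :
    factorAt α (i - R) (R + 1) = factorAt α (j - R) (R + 1) := by
  rw [factorAt_eq_factorAt_iff]
  intro k hk
  obtain ⟨hi, hj, h⟩ := h
  have := h (R - k) (by omega)
  rwa [show i - (R - k) = i - R + k by omega, show j - (R - k) = j - R + k by omega] at this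

/-- The positions of a word over a finite alphabet can be coded by finitely many letters, in such
a way that the positions from `R` on are coded by the windows of length `R + 1` ending there. -/
theorem exists_windowCoding [Finite A] (α : ℕ → A) (R : ℕ) :
    ∃ (m : ℕ) (β : ℕ → Fin m), Function.Surjective β ∧
      ∀ i j, β i = β j ↔ i = j ∨ WindowEq α R i j := by
  -- The first component isolates the positions below `R`, where the truncated subtraction `i - k`
  -- yields no genuine window.
  let f : ℕ → Fin (R + 1) × (Fin (R + 1) → A) := fun i =>
    (⟨min i R, by omega⟩, fun k => α (i - k))
  obtain ⟨m, ⟨e⟩⟩ := Finite.exists_equiv_fin (Set.range f)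
  refine ⟨m, fun i => e (Set.rangeFactorization f i),
    e.surjective.comp Set.rangeFactorization_surjective, fun i j => ?_⟩
  have hf : f i = f j ↔ min i R = min j R ∧ ∀ k ≤ R, α (i - k) = α (j - k) := by
    simp only [f, Prod.mk.injEq, Fin.mk.injEq, funext_iff, Fin.forall_iff, Nat.lt_succ_iff]
  rw [e.injective.eq_iff, Subtype.ext_iff]
  change f i = f j ↔ _
  rw [hf]
  constructor
  · rintro ⟨h1, h2⟩
    by_cases hij : i = j
    · exact Or.inl hij
    · exact Or.inr ⟨by omega, by omega, h2⟩
  · rintro (rfl | ⟨h1, h2, h3⟩)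
    · exact ⟨rfl, fun _ _ => rfl⟩
    · exact ⟨by omega, h3⟩

/-- Gaps are at most M, so a window reaching back M+1 letters contains the last letter satisfying
`P` strictly before its end. -/
theorem WindowEq.gap_le_gap {P : A → Prop} {α : ℕ → A} (h0 : P (α 0)) {M : ℕ}
    (hM : ∀ i n, (∀ k < n, ¬ P (α (i + k))) → n ≤ M) {i j : ℕ}
    (h : WindowEq α (M + 1) i j) : gap P α M i ≤ gap P α M j := by
  have hj := gap_le h0 hM j
  obtain ⟨hi1, hj1, h⟩ := h
  obtain ⟨i, rfl⟩ := Nat.exists_eq_add_of_le' (show 1 ≤ i by omega)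
  obtain ⟨j, rfl⟩ := Nat.exists_eq_add_of_le' (show 1 ≤ j by omega)
  by_contra! hlt
  have h1 := (gap_spec h0 M i).2.2 _ hlt
  have h2 := (gap_spec h0 M j).2.1
  have h3 := h (gap P α M (j + 1) + 1) (by omega)
  rw [Nat.add_sub_add_right, Nat.add_sub_add_right] at h3
  exact h1 (h3 ▸ h2)

theorem WindowEq.gap_eq {P : A → Prop} {α : ℕ → A} (h0 : P (α 0)) {M : ℕ}
    (hM : ∀ i n, (∀ k < n, ¬ P (α (i + k))) → n ≤ M) {i j : ℕ}
    (h : WindowEq α (M + 1) i j) : gap P α M i = gap P α M j :=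
  le_antisymm (h.gap_le_gap h0 hM) (h.symm.gap_le_gap h0 hM)

theorem WindowEq.gap_succ_eq {P : A → Prop} {α : ℕ → A} (h0 : P (α 0)) {M : ℕ}
    (hM : ∀ i n, (∀ k < n, ¬ P (α (i + k))) → n ≤ M) {i j : ℕ}
    (h : WindowEq α (M + 1) i j) : gap P α M (i + 1) = gap P α M (j + 1) := by
  have h1 : α i = α j := by simpa using h.2.2 0 (Nat.zero_le _)
  by_cases hi : P (α i)
  · rw [gap_succ_of_pos M hi, gap_succ_of_pos M (h1 ▸ hi)]
  · rw [gap_succ_of_neg M hi, gap_succ_of_neg M (h1 ▸ hi), h.gap_eq h0 hM]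

/-- If the letters satisfying `P` occur in `α` with bounded gaps and have long enough images under
`Φ`, then `α` has a certificate. -/
theorem exists_isCertificate_of_bounded_gaps [Finite A] {P : A → Prop} {α : ℕ → A}
    (h0 : P (α 0)) {M : ℕ} (hM : ∀ i n, (∀ k < n, ¬ P (α (i + k))) → n ≤ M)
    {Φ : FreeMonoid A →* FreeMonoid A} (hΦ : ∀ w, IsPrefixOf w α → IsPrefixOf (Φ w) α)
    (hlen : ∀ c, P c → 3 * M + 3 ≤ (Φ (FreeMonoid.of c)).length) :
    ∃ (m : ℕ) (σ : FreeMonoid (Fin m) →* FreeMonoid (Fin m)) (b : Fin m) (π : Fin m → A)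
      (t : Fin m → FreeMonoid A) (T : Fin m → Fin m → Prop),
      IsCertificate Φ (α 0) σ b π t T := by
  obtain ⟨m, β, hβ, hβiff⟩ := exists_windowCoding α (M + 1)
  let r := gap P α M
  have hr : ∀ i, r i ≤ M := gap_le h0 hM
  let G : ℕ → ℕ := fun i => (Φ (factorAt α 0 i)).length
  -- The lag drops by 2 at each letter outside `P`, even one with empty image, and is reset to 2M
  -- after a letter in `P`. The initial value `r 0 = M` gives `g 0 = 0`.
  let g : ℕ → ℕ := fun i => G i - 2 * (M - r i)
  have hG0 : G 0 = 0 := by simp [G]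
  have hGadd : ∀ i n, G (i + n) = G i + (Φ (factorAt α i n)).length := fun i n => by
    simp only [G]
    rw [factorAt_add, map_mul, FreeMonoid.length_mul, Nat.zero_add]
  have hGmono : Monotone G := monotone_nat_of_le_succ fun i => by
    rw [hGadd]
    exact Nat.le_add_right _ _
  have hGpos : ∀ i, P (α i) → G i + (3 * M + 3) ≤ G (i + 1) := fun i hi => by
    rw [hGadd, factorAt_one]
    exact Nat.add_le_add_left (hlen _ hi) _
  have hlag : ∀ i, 2 * (M - r i) ≤ G i := by
    rintro (_ | i)
    · simp [r, gap]
    · have h1 : G 0 + (3 * M + 3) ≤ G 1 := hGpos 0 h0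
      have h2 : G 1 ≤ G (i + 1) := hGmono (by omega)
      omega
  have hg : ∀ i, g i + 2 ≤ g (i + 1) := by
    intro i
    have h1 := hlag i
    have h2 := hlag (i + 1)
    have h3 := hr (i + 1)
    have h4 : G i ≤ G (i + 1) := hGmono (Nat.le_succ i)
    simp only [g]
    by_cases hi : P (α i)
    · have h5 := hGpos i hi
      omega
    · have h5 : r (i + 1) = r i + 1 := gap_succ_of_neg M hi
      omega
  have hgG : ∀ i, g i ≤ G i := fun i => Nat.sub_le _ _
  -- One of the M+1 letters before `i` satisfies `P`; its 3M+3 image letters leave room for a lag of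
  -- 2M and a further window reach of M+1.
  have hback : ∀ i, M + 1 ≤ i → G (i - (M + 1)) + (3 * M + 3) ≤ G i := by
    intro i hi
    obtain ⟨i, rfl⟩ := Nat.exists_eq_add_of_le' (show 1 ≤ i by omega)
    have h1 := hGpos _ (gap_spec h0 M i).2.1
    have h2 : gap P α M (i + 1) ≤ M := hr (i + 1)
    have h3 : G (i + 1 - (M + 1)) ≤ G (i - gap P α M (i + 1)) := hGmono (by omega)
    have h4 : G (i - gap P α M (i + 1) + 1) ≤ G (i + 1) := hGmono (by omega)
    omega
  -- Equal windows have equal images, so α looks the same around both blocks, from `G (i - (M + 1))`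
  -- up to `G (i + 1)`.
  have hwin : ∀ i j, WindowEq α (M + 1) i j →
      G i - G (i - (M + 1)) = G j - G (j - (M + 1)) ∧
      G (i + 1) - G (i - (M + 1)) = G (j + 1) - G (j - (M + 1)) ∧
      ∀ s < G (i + 1) - G (i - (M + 1)),
        α (G (i - (M + 1)) + s) = α (G (j - (M + 1)) + s) := by
    intro i j h
    have hw := h.factorAt_eq
    have hw' : factorAt α (i - (M + 1)) (M + 1) = factorAt α (j - (M + 1)) (M + 1) := by
      rw [factorAt_eq_factorAt_iff] at hw ⊢
      exact fun k hk => hw k (by omega)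
    have e1 : ∀ i, M + 1 ≤ i → G i - G (i - (M + 1)) =
        (Φ (factorAt α (i - (M + 1)) (M + 1))).length := fun i hi => by
      have := hGadd (i - (M + 1)) (M + 1)
      rw [Nat.sub_add_cancel hi] at this
      omega
    have e2 : ∀ i, M + 1 ≤ i → G (i + 1) - G (i - (M + 1)) =
        (Φ (factorAt α (i - (M + 1)) (M + 1 + 1))).length := fun i hi => by
      have := hGadd (i - (M + 1)) (M + 1 + 1)
      rw [show i - (M + 1) + (M + 1 + 1) = i + 1 by omega] at this
      omega
    refine ⟨by rw [e1 i h.1, e1 j h.2.1, hw'], by rw [e2 i h.1, e2 j h.2.1, hw], ?_⟩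
    have hi := map_factorAt_of_isPrefixOf hΦ (i - (M + 1)) (M + 1 + 1)
    have hj := map_factorAt_of_isPrefixOf hΦ (j - (M + 1)) (M + 1 + 1)
    rw [← hw, hi, length_factorAt, factorAt_eq_factorAt_iff] at hj
    rw [e2 i h.1]
    exact hj
  suffices ∃ (σ : FreeMonoid (Fin m) →* FreeMonoid (Fin m)) (π : Fin m → A)
      (t : Fin m → FreeMonoid A) (T : Fin m → Fin m → Prop),
      IsCertificate Φ (α 0) σ (β 0) π t T by
    obtain ⟨σ, π, t, T, h⟩ := this
    exact ⟨m, σ, β 0, π, t, T, h⟩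
  refine exists_isCertificate_of_cut hΦ hβ (G := G) (g := g) (fun _ => rfl) hgG (by simp [g, hG0])
    hg ?_ ?_ ?_ ?_
  · intro i j hij
    rcases (hβiff i j).1 hij with rfl | h
    · rfl
    · simpa using h.2.2 0 (Nat.zero_le _)
  · intro i j hij h1
    rcases (hβiff i j).1 hij with rfl | h
    · rfl
    · exact (hβiff _ _).2 (Or.inr (h.succ h1))
  · intro i j hij
    rcases (hβiff i j).1 hij with rfl | h
    · rfl
    · obtain ⟨w1, w2, w3⟩ := hwin i j h
      have r1 : r i = r j := h.gap_eq h0 hM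
      have r2 : r (i + 1) = r (j + 1) := h.gap_succ_eq h0 hM
      have bi := hback i h.1
      have bj := hback j h.2.1
      have mi : G i ≤ G (i + 1) := hGmono (Nat.le_succ i)
      have mj : G j ≤ G (j + 1) := hGmono (Nat.le_succ j)
      have li := hlag (i + 1)
      have lj := hlag (j + 1)
      have hn : g (i + 1) - g i = g (j + 1) - g j := by
        simp only [g]
        omega
      rw [hn, factorAt_eq_factorAt_iff]
      intro s hs
      -- By `hback`, the whole window ending at any position of the block lies in the stretch
      -- compared by `hwin`.
      refine (hβiff _ _).2 (Or.inr ⟨?_, ?_, fun k hk => ?_⟩)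
      · simp only [g]
        omega
      · simp only [g]
        omega
      · have := w3 (g i + s - k - G (i - (M + 1))) (by simp only [g] at *; omega)
        rwa [show G (i - (M + 1)) + (g i + s - k - G (i - (M + 1))) = g i + s - k by
            simp only [g]; omega,
          show G (j - (M + 1)) + (g i + s - k - G (i - (M + 1))) = g j + s - k by
            simp only [g]; omega] at this
  · intro i j hij
    rcases (hβiff i j).1 hij with rfl | h
    · rfl
    · obtain ⟨w1, w2, w3⟩ := hwin i j h
      have r1 : r i = r j := h.gap_eq h0 hM
      have bi := hback i h.1
      have bj := hback j h.2.1
      have mi : G i ≤ G (i + 1) := hGmono (Nat.le_succ i)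
      have hn : G i - g i = G j - g j := by
        simp only [g]
        omega
      rw [hn, factorAt_eq_factorAt_iff]
      intro s hs
      have := w3 (g i + s - G (i - (M + 1))) (by simp only [g] at *; omega)
      rwa [show G (i - (M + 1)) + (g i + s - G (i - (M + 1))) = g i + s by
          simp only [g]; omega,
        show G (j - (M + 1)) + (g i + s - G (i - (M + 1))) = g j + s by
          simp only [g]; omega] at this

/-- The growing letters play the role of `P`; by finiteness one exponent makes all their images long
enough. -/
theorem exists_isCertificate [Finite A] {φ : FreeMonoid A →* FreeMonoid A} {a : A} {α : ℕ → A}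
    (hα : IsPureMorphic φ a α) (hB : BoundedFactorsBounded φ α) :
    ∃ p : ℕ, ∀ Φ : FreeMonoid A →* FreeMonoid A, (∀ w, Φ w = φ^[p] w) →
      ∃ (m : ℕ) (σ : FreeMonoid (Fin m) →* FreeMonoid (Fin m)) (b : Fin m) (π : Fin m → A)
        (t : Fin m → FreeMonoid A) (T : Fin m → Fin m → Prop), IsCertificate Φ a σ b π t T := by
  obtain ⟨M, hM⟩ := hB.exists_le
  obtain ⟨p, hp⟩ := exists_forall_le_length_iterate φ (3 * M + 3)
  refine ⟨p, fun Φ hΦ => ?_⟩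
  have ha := hα.apply_zero
  subst ha
  refine exists_isCertificate_of_bounded_gaps (P := fun c => ¬ IsBoundedLetter φ c)
    hα.not_isBoundedLetter (M := M) (fun i n h => hM i n fun k hk => not_not.1 (h k hk))
    (fun w hw => ?_) (fun c hc => ?_)
  · rw [hΦ]
    exact hα.isPrefixOf_iterate p hw
  · rw [hΦ]
    exact hp c hc

end Window

/-! ### Certificates as lists of natural numbers -/

section Codes

variable {m n : ℕ}

/-- The list of natural numbers describing a word over `{0, …, n-1}`. -/
def wordCode (w : FreeMonoid (Fin n)) : List ℕ := w.toList.map fun x : Fin n => (x : ℕ)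

theorem wordCode_injective : Function.Injective (wordCode : FreeMonoid (Fin n) → List ℕ) :=
  fun _ _ h => FreeMonoid.toList.injective (List.map_injective_iff.2 Fin.val_injective h)

@[simp] theorem wordCode_inj {u v : FreeMonoid (Fin n)} : wordCode u = wordCode v ↔ u = v :=
  wordCode_injective.eq_iff

@[simp] theorem wordCode_one : wordCode (1 : FreeMonoid (Fin n)) = [] := rfl

@[simp] theorem wordCode_of (x : Fin n) : wordCode (FreeMonoid.of x) = [(x : ℕ)] := rfl

@[simp] theorem wordCode_mul (u v : FreeMonoid (Fin n)) :
    wordCode (u * v) = wordCode u ++ wordCode v := List.map_append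

@[simp] theorem length_wordCode (w : FreeMonoid (Fin n)) : (wordCode w).length = w.length :=
  List.length_map _

theorem lt_of_mem_wordCode {w : FreeMonoid (Fin n)} {x : ℕ} (h : x ∈ wordCode w) : x < n := by
  obtain ⟨y, -, rfl⟩ := List.mem_map.1 h
  exact y.2

theorem exists_wordCode_eq {l : List ℕ} (h : ∀ x ∈ l, x < n) :
    ∃ w : FreeMonoid (Fin n), wordCode w = l := by
  induction l with
  | nil => exact ⟨1, rfl⟩
  | cons x l ih =>
    obtain ⟨w, hw⟩ := ih fun y hy => h y (List.mem_cons_of_mem _ hy)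
    exact ⟨FreeMonoid.of ⟨x, h x List.mem_cons_self⟩ * w, by simp [hw]⟩

@[simp] theorem length_code (φ : FreeMonoid (Fin m) →* FreeMonoid (Fin n)) :
    (code φ).length = m := by simp [code]

theorem getD_code (φ : FreeMonoid (Fin m) →* FreeMonoid (Fin n)) (x : Fin m) :
    (code φ).getD x [] = wordCode (φ (FreeMonoid.of x)) := by
  simp [code, wordCode, List.getD_eq_getElem?_getD]

theorem forall_mem_code {φ : FreeMonoid (Fin m) →* FreeMonoid (Fin n)} {p : List ℕ → Prop} :
    (∀ l ∈ code φ, p l) ↔ ∀ x, p (wordCode (φ (FreeMonoid.of x))) := by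
  simp only [code, List.mem_ofFn, forall_exists_index, forall_apply_eq_imp_iff]
  rfl

theorem exists_code_eq {c : List (List ℕ)} (hm : c.length = m) (h : ∀ l ∈ c, ∀ x ∈ l, x < n) :
    ∃ φ : FreeMonoid (Fin m) →* FreeMonoid (Fin n), code φ = c := by
  subst hm
  choose f hf using fun i : Fin c.length => exists_wordCode_eq (h _ (List.get_mem c i))
  refine ⟨FreeMonoid.lift f, ?_⟩
  exact (congrArg List.ofFn (funext hf)).trans (List.ofFn_get c)

/-- The image of a word under the morphism described by `c`. -/
def applyCode (c : List (List ℕ)) (w : List ℕ) : List ℕ := w.flatMap fun x => c.getD x []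

@[simp] theorem applyCode_code (φ : FreeMonoid (Fin m) →* FreeMonoid (Fin n))
    (w : FreeMonoid (Fin m)) : applyCode (code φ) (wordCode w) = wordCode (φ w) := by
  induction w using FreeMonoid.inductionOn' with
  | one => simp [applyCode]
  | of_mul x w ih =>
    rw [map_mul, wordCode_mul, wordCode_mul, ← ih]
    simp only [applyCode, wordCode_of, List.flatMap_append, List.flatMap_cons, List.flatMap_nil,
      List.append_nil, getD_code]

theorem iterate_applyCode_code (φ : FreeMonoid (Fin n) →* FreeMonoid (Fin n)) (p : ℕ)
    (w : FreeMonoid (Fin n)) : (applyCode (code φ))^[p] (wordCode w) = wordCode (φ^[p] w) := by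
  induction p with
  | zero => rfl
  | succ p ih => rw [Function.iterate_succ', Function.comp_apply, ih, applyCode_code,
      Function.iterate_succ', Function.comp_apply]

/-- The pairs of consecutive letters of the word `l` belong to `T`. -/
def ConsecutiveIn (T : List (ℕ × ℕ)) (l : List ℕ) : Prop :=
  ∀ i ∈ List.range (l.length - 1), (l.getD i 0, l.getD (i + 1) 0) ∈ T

theorem consecutiveIn_iff_isChain {T : List (ℕ × ℕ)} {l : List ℕ} :
    ConsecutiveIn T l ↔ l.IsChain fun x y => (x, y) ∈ T := by
  rw [ConsecutiveIn, List.isChain_iff_getElem]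
  simp only [List.mem_range]
  refine forall_congr' fun i => ⟨fun h hi => ?_, fun h hi => ?_⟩
  · have := h (by omega)
    rwa [List.getD_eq_getElem _ _ (by omega), List.getD_eq_getElem _ _ hi] at this
  · rw [List.getD_eq_getElem _ _ (by omega), List.getD_eq_getElem _ _ (by omega)]
    exact h (by omega)

theorem consecutiveIn_wordCode {T : List (ℕ × ℕ)} {w : FreeMonoid (Fin n)} :
    ConsecutiveIn T (wordCode w) ↔ w.toList.IsChain fun x y : Fin n => ((x : ℕ), (y : ℕ)) ∈ T := by
  rw [consecutiveIn_iff_isChain, wordCode, List.isChain_map]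

/-- Descriptions of certificates: the morphism `σ`, the letter `b`, the coding `ψ`, the exponent
`p`, the lags `t` and the pairs of consecutive letters `T`. -/
abbrev CertificateCode : Type :=
  (List (List ℕ) × ℕ × List (List ℕ)) × ℕ × List (List ℕ) × List (ℕ × ℕ)

/-- The description `y` is the one of a certificate for the morphism and the letter
described by `x`. -/
def IsValid (x : List (List ℕ) × ℕ) (y : CertificateCode) : Prop :=
  ((∀ l ∈ y.1.1, ∀ i ∈ l, i < y.1.1.length) ∧
    (∀ l ∈ y.1.2.2, ∀ i ∈ l, i < x.1.length) ∧
    (∀ l ∈ y.2.2.1, ∀ i ∈ l, i < x.1.length) ∧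
    y.1.2.2.length = y.1.1.length ∧ y.2.2.1.length = y.1.1.length ∧ y.1.2.1 < y.1.1.length) ∧
  ((y.1.1.getD y.1.2.1 []).head? = some y.1.2.1 ∧
    (∀ l ∈ y.1.1, 2 ≤ l.length) ∧
    (∀ l ∈ y.1.2.2, l.length = 1) ∧
    y.1.2.2.getD y.1.2.1 [] = [x.2] ∧
    y.2.2.1.getD y.1.2.1 [] = []) ∧
  (∀ l ∈ y.1.1, ConsecutiveIn y.2.2.2 l) ∧
  (∀ q ∈ y.2.2.2, ConsecutiveIn y.2.2.2 (applyCode y.1.1 [q.1, q.2])) ∧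
  (∀ q ∈ y.2.2.2, applyCode y.1.2.2 (y.1.1.getD q.1 []) ++ y.2.2.1.getD q.2 [] =
    y.2.2.1.getD q.1 [] ++ (applyCode x.1)^[y.2.1] (y.1.2.2.getD q.1 [])) ∧
  ∀ q ∈ y.2.2.2, ∀ q' ∈ y.2.2.2,
    q.1 = q'.1 → y.1.2.2.getD q.2 [] = y.1.2.2.getD q'.2 [] → q.2 = q'.2

theorem IsCertificate.exists_isValid {φ Φ : FreeMonoid (Fin n) →* FreeMonoid (Fin n)} {p : ℕ}
    (hΦ : ∀ w, Φ w = φ^[p] w) {a : Fin n} {σ : FreeMonoid (Fin m) →* FreeMonoid (Fin m)}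
    {b : Fin m} {π : Fin m → Fin n} {t : Fin m → FreeMonoid (Fin n)} {T : Fin m → Fin m → Prop}
    (h : IsCertificate Φ a σ b π t T) :
    ∃ y : CertificateCode, IsValid (code φ, (a : ℕ)) y := by
  classical
  let Tl : List (ℕ × ℕ) := ((Finset.univ.filter fun q : Fin m × Fin m => T q.1 q.2).toList.map
    fun q => ((q.1 : ℕ), (q.2 : ℕ)))
  have hTl : ∀ q : ℕ × ℕ, q ∈ Tl ↔ ∃ x y, T x y ∧ ((x : ℕ), (y : ℕ)) = q := by
    simp [Tl, Prod.exists]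
  have hTl' : (fun x y : Fin m => ((x : ℕ), (y : ℕ)) ∈ Tl) = T := by
    funext x y
    rw [hTl]
    refine propext ⟨?_, fun hxy => ⟨x, y, hxy, rfl⟩⟩
    rintro ⟨x', y', hxy, he⟩
    rw [Prod.mk.injEq, Fin.val_inj, Fin.val_inj] at he
    rwa [← he.1, ← he.2]
  have happ : ∀ x y : Fin m, applyCode (code σ) [(x : ℕ), (y : ℕ)] =
      wordCode (σ (FreeMonoid.of x * FreeMonoid.of y)) := fun x y => by
    rw [← applyCode_code]
    rfl
  obtain ⟨u, hu⟩ := h.head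
  refine ⟨((code σ, (b : ℕ), code (FreeMonoid.map π)), p, code (FreeMonoid.lift t), Tl),
    ⟨?_, ?_, ?_, ?_, ?_, ?_⟩, ⟨?_, ?_, ?_, ?_, ?_⟩, ?_, ?_, ?_, ?_⟩
  · simp only [forall_mem_code, length_code]
    exact fun x i => lt_of_mem_wordCode
  · simp only [forall_mem_code, length_code]
    exact fun x i => lt_of_mem_wordCode
  · simp only [forall_mem_code, length_code]
    exact fun x i => lt_of_mem_wordCode
  · simp
  · simp
  · simp
  · simp only [getD_code, hu, wordCode_mul, wordCode_of, List.singleton_append, List.head?_cons]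
  · simpa only [forall_mem_code, length_wordCode] using h.two_le
  · simp [forall_mem_code]
  · simp only [getD_code, FreeMonoid.map_of, wordCode_of, h.letter]
  · simp only [getD_code, FreeMonoid.lift_eval_of, h.lag, wordCode_one]
  · simpa only [forall_mem_code, consecutiveIn_wordCode, hTl'] using h.chain
  · intro q hq
    obtain ⟨x, y, hxy, rfl⟩ := (hTl q).1 hq
    simpa only [happ, consecutiveIn_wordCode, hTl'] using h.chain_mul x y hxy
  · intro q hq
    obtain ⟨x, y, hxy, rfl⟩ := (hTl q).1 hq
    simpa only [getD_code, applyCode_code, iterate_applyCode_code, ← wordCode_mul, wordCode_inj,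
      FreeMonoid.map_of, FreeMonoid.lift_eval_of, hΦ] using h.conj x y hxy
  · intro q hq q' hq' h1 h2
    obtain ⟨x, y, hxy, rfl⟩ := (hTl q).1 hq
    obtain ⟨x', y', hxy', rfl⟩ := (hTl q').1 hq'
    obtain rfl : x = x' := Fin.val_injective h1
    simp only [getD_code, wordCode_inj, FreeMonoid.map_of] at h2
    rw [h.det x y y' hxy hxy' (FreeMonoid.of_injective h2)]

/-- Pairs of `T` with entries outside the alphabet only add constraints and are dropped on
restricting to `Fin m`. -/
theorem IsValid.exists_isCertificate {φ Φ : FreeMonoid (Fin n) →* FreeMonoid (Fin n)} {a : Fin n}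
    {y : CertificateCode} (h : IsValid (code φ, (a : ℕ)) y) (hΦ : ∀ w, Φ w = φ^[y.2.1] w) :
    ∃ (m : ℕ) (σ : FreeMonoid (Fin m) →* FreeMonoid (Fin m)) (b : Fin m) (π : Fin m → Fin n)
      (t : Fin m → FreeMonoid (Fin n)) (T : Fin m → Fin m → Prop),
      IsCertificate Φ a σ b π t T ∧ y.1 = (code σ, (b : ℕ), code (FreeMonoid.map π)) := by
  obtain ⟨⟨s, b, c⟩, p, t, T⟩ := y
  obtain ⟨⟨h1, h2, h3, h4, h5, h6⟩, ⟨h7, h8, h9, h10, h11⟩, h12, h13, h14, h15⟩ := h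
  dsimp only at *
  obtain ⟨m, hm⟩ : ∃ m, s.length = m := ⟨_, rfl⟩
  rw [hm] at h1 h4 h5 h6
  obtain ⟨σ, rfl⟩ := exists_code_eq hm h1
  simp only [length_code] at h2 h3
  obtain ⟨ψ, rfl⟩ := exists_code_eq h4 h2
  obtain ⟨τ, rfl⟩ := exists_code_eq h5 h3
  obtain ⟨b, rfl⟩ : ∃ b' : Fin m, (b' : ℕ) = b := ⟨⟨b, h6⟩, rfl⟩
  simp only [forall_mem_code, length_wordCode, FreeMonoid.length_eq_one] at h8 h9
  choose π hπ using h9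
  -- Images of length 1 make ψ a letter-to-letter coding, which is non-erasing.
  obtain rfl : ψ = FreeMonoid.map π := FreeMonoid.hom_eq hπ
  have happ : ∀ x y : Fin m, applyCode (code σ) [(x : ℕ), (y : ℕ)] =
      wordCode (σ (FreeMonoid.of x * FreeMonoid.of y)) := fun x y => by
    rw [← applyCode_code]
    rfl
  refine ⟨m, σ, b, π, fun x => τ (FreeMonoid.of x), fun x y => ((x : ℕ), (y : ℕ)) ∈ T,
    ⟨?_, h8, ?_, ?_, ?_, ?_, ?_, ?_⟩, rfl⟩
  · rw [getD_code] at h7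
    cases hw : σ (FreeMonoid.of b) using FreeMonoid.casesOn with
    | one => simp [hw] at h7
    | of_mul x w =>
      rw [hw] at h7
      obtain rfl : x = b := by simpa [Fin.val_inj] using h7
      exact ⟨w, rfl⟩
  · rw [getD_code] at h10
    simpa [Fin.val_inj] using h10
  · rw [getD_code, ← wordCode_one (n := n), wordCode_inj] at h11
    exact h11
  · simpa only [forall_mem_code, consecutiveIn_wordCode] using h12
  · intro x y hxy
    simpa only [happ, consecutiveIn_wordCode] using h13 _ hxy
  · intro x y hxy
    simpa only [getD_code, applyCode_code, iterate_applyCode_code, ← wordCode_mul, wordCode_inj,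
      FreeMonoid.map_of, hΦ] using h14 _ hxy
  · intro x y z hxy hxz hyz
    refine Fin.val_injective (h15 _ hxy _ hxz rfl ?_)
    simp only [getD_code, FreeMonoid.map_of, hyz]

end Codes

/-! ### Primitive recursive checking and unbounded search -/

section Computability

theorem primrecPred_forall_mem {α β : Type*} [Primcodable α] [Primcodable β] {f : α → List β}
    {p : α → β → Prop} (hf : Primrec f) (hp : PrimrecPred fun z : α × β => p z.1 z.2) :
    PrimrecPred fun a => ∀ b ∈ f a, p a b :=
  (PrimrecRel.forall_mem_list (R := fun b a => p a b) (PrimrecRel.swap hp)).comp hf Primrec.id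

section

variable {α : Type*} [Primcodable α] {c : α → List (List ℕ)} {w : α → List ℕ} {k : α → ℕ}
  {T : α → List (ℕ × ℕ)}

theorem primrec_getD_nil (hc : Primrec c) (hk : Primrec k) :
    Primrec fun a => (c a).getD (k a) [] := (Primrec.list_getD []).comp hc hk

theorem primrec_getD_zero (hw : Primrec w) (hk : Primrec k) :
    Primrec fun a => (w a).getD (k a) 0 := (Primrec.list_getD 0).comp hw hk

theorem primrec_applyCode (hc : Primrec c) (hw : Primrec w) :
    Primrec fun a => applyCode (c a) (w a) :=
  Primrec.list_flatMap hw (primrec_getD_nil (hc.comp .fst) .snd)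

theorem primrec_iterate_applyCode (hc : Primrec c) (hk : Primrec k) (hw : Primrec w) :
    Primrec fun a => (applyCode (c a))^[k a] (w a) :=
  Primrec.nat_iterate hk hw (primrec_applyCode (hc.comp .fst) .snd)

theorem primrecPred_mem {β : Type*} [Primcodable β] {l : α → List β} {f : α → β} (hl : Primrec l)
    (hf : Primrec f) : PrimrecPred fun a => f a ∈ l a :=
  (PrimrecRel.comp (PrimrecRel.exists_mem_list (R := Eq) Primrec.eq) hl hf).of_eq (by simp)

theorem primrecPred_consecutiveIn (hT : Primrec T) (hw : Primrec w) :
    PrimrecPred fun a => ConsecutiveIn (T a) (w a) :=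
  primrecPred_forall_mem
    (Primrec.list_range.comp (Primrec.nat_sub.comp (Primrec.list_length.comp hw) (.const 1)))
    (primrecPred_mem (hT.comp .fst) (Primrec.pair (primrec_getD_zero (hw.comp .fst) .snd)
      (primrec_getD_zero (hw.comp .fst) (Primrec.succ.comp .snd))))

theorem primrecPred_forall_mem_lt (hc : Primrec c) (hk : Primrec k) :
    PrimrecPred fun a => ∀ l ∈ c a, ∀ i ∈ l, i < k a :=
  primrecPred_forall_mem hc (primrecPred_forall_mem .snd
    (Primrec.nat_lt.comp .snd (hk.comp (Primrec.fst.comp .fst))))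

end

theorem primrecPred_isValid :
    PrimrecPred fun z : (List (List ℕ) × ℕ) × CertificateCode => IsValid z.1 z.2 := by
  have hφ : Primrec fun z : (List (List ℕ) × ℕ) × CertificateCode => z.1.1 :=
    Primrec.fst.comp .fst
  have ha : Primrec fun z : (List (List ℕ) × ℕ) × CertificateCode => z.1.2 :=
    Primrec.snd.comp .fst
  have hσ : Primrec fun z : (List (List ℕ) × ℕ) × CertificateCode => z.2.1.1 :=
    Primrec.fst.comp (Primrec.fst.comp .snd)
  have hb : Primrec fun z : (List (List ℕ) × ℕ) × CertificateCode => z.2.1.2.1 :=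
    Primrec.fst.comp (Primrec.snd.comp (Primrec.fst.comp .snd))
  have hψ : Primrec fun z : (List (List ℕ) × ℕ) × CertificateCode => z.2.1.2.2 :=
    Primrec.snd.comp (Primrec.snd.comp (Primrec.fst.comp .snd))
  have hp : Primrec fun z : (List (List ℕ) × ℕ) × CertificateCode => z.2.2.1 :=
    Primrec.fst.comp (Primrec.snd.comp .snd)
  have ht : Primrec fun z : (List (List ℕ) × ℕ) × CertificateCode => z.2.2.2.1 :=
    Primrec.fst.comp (Primrec.snd.comp (Primrec.snd.comp .snd))
  have hT : Primrec fun z : (List (List ℕ) × ℕ) × CertificateCode => z.2.2.2.2 :=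
    Primrec.snd.comp (Primrec.snd.comp (Primrec.snd.comp .snd))
  have hlen {c : (List (List ℕ) × ℕ) × CertificateCode → List (List ℕ)} (hc : Primrec c) :
      Primrec fun z => (c z).length := Primrec.list_length.comp hc
  refine .and (.and (primrecPred_forall_mem_lt hσ (hlen hσ)) <|
    .and (primrecPred_forall_mem_lt hψ (hlen hφ)) <|
    .and (primrecPred_forall_mem_lt ht (hlen hφ)) <|
    .and (Primrec.eq.comp (hlen hψ) (hlen hσ)) <|
    .and (Primrec.eq.comp (hlen ht) (hlen hσ)) (Primrec.nat_lt.comp hb (hlen hσ))) <|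
    .and (.and (Primrec.eq.comp (Primrec.list_head?.comp (primrec_getD_nil hσ hb))
      (Primrec.option_some.comp hb)) <|
    .and (primrecPred_forall_mem hσ
      (Primrec.nat_le.comp (.const 2) (Primrec.list_length.comp .snd))) <|
    .and (primrecPred_forall_mem hψ
      (Primrec.eq.comp (Primrec.list_length.comp .snd) (.const 1))) <|
    .and (Primrec.eq.comp (primrec_getD_nil hψ hb) (Primrec.list_cons.comp ha (.const [])))
      (Primrec.eq.comp (primrec_getD_nil ht hb) (.const []))) <|
    .and (primrecPred_forall_mem hσ (primrecPred_consecutiveIn (hT.comp .fst) .snd)) <|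
    .and (primrecPred_forall_mem hT (primrecPred_consecutiveIn (hT.comp .fst)
      (primrec_applyCode (hσ.comp .fst) (Primrec.list_cons.comp (Primrec.fst.comp .snd)
        (Primrec.list_cons.comp (Primrec.snd.comp .snd) (.const [])))))) <|
    .and (primrecPred_forall_mem hT (Primrec.eq.comp
      (Primrec.list_append.comp
        (primrec_applyCode (hψ.comp .fst) (primrec_getD_nil (hσ.comp .fst) (Primrec.fst.comp .snd)))
        (primrec_getD_nil (ht.comp .fst) (Primrec.snd.comp .snd)))
      (Primrec.list_append.comp
        (primrec_getD_nil (ht.comp .fst) (Primrec.fst.comp .snd))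
        (primrec_iterate_applyCode (hφ.comp .fst) (hp.comp .fst)
          (primrec_getD_nil (hψ.comp .fst) (Primrec.fst.comp .snd)))))) ?_
  refine primrecPred_forall_mem hT (primrecPred_forall_mem (hT.comp .fst) ?_)
  -- The determinism clause is a chain of implications between equalities, treated as a disjunction
  -- with negated premises.
  have h1 := Primrec.eq.comp
    (Primrec.fst.comp (Primrec.snd.comp (Primrec.fst
      (α := ((List (List ℕ) × ℕ) × CertificateCode) × ℕ × ℕ) (β := ℕ × ℕ))))
    (Primrec.fst.comp Primrec.snd)
  have h2 := Primrec.eq.comp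
    (primrec_getD_nil (hψ.comp (Primrec.fst.comp Primrec.fst))
      (Primrec.snd.comp (Primrec.snd.comp (Primrec.fst
        (α := ((List (List ℕ) × ℕ) × CertificateCode) × ℕ × ℕ) (β := ℕ × ℕ)))))
    (primrec_getD_nil (hψ.comp (Primrec.fst.comp Primrec.fst)) (Primrec.snd.comp Primrec.snd))
  have h3 := Primrec.eq.comp
    (Primrec.snd.comp (Primrec.snd.comp (Primrec.fst
      (α := ((List (List ℕ) × ℕ) × CertificateCode) × ℕ × ℕ) (β := ℕ × ℕ))))
    (Primrec.snd.comp Primrec.snd)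
  refine (h1.not.or (h2.not.or h3)).of_eq fun z => ?_
  simp only [imp_iff_not_or]

/-- A primitive recursive predicate can be searched for a witness. -/
theorem exists_partrec_search {α β γ : Type*} [Primcodable α] [Primcodable β] [Primcodable γ]
    {p : α → β → Prop} (hp : PrimrecPred fun z : α × β => p z.1 z.2) {f : β → γ} (hf : Primrec f) :
    ∃ s : α →. γ, Partrec s ∧ ∀ x, (∃ y, p x y) → ∃ y, p x y ∧ f y ∈ s x := by
  classical
  -- Every natural number is tried as the encoding of a candidate witness.
  let step : α → ℕ → Option γ := fun x k =>
    (Encodable.decode (α := β) k).bind fun y => if p x y then some (f y) else none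
  have hstep : Computable₂ step := by
    refine Primrec.to_comp (Primrec.option_bind (Primrec.decode.comp .snd) ?_)
    exact Primrec.ite (hp.comp (Primrec.pair (Primrec.fst.comp .fst) .snd))
      (Primrec.option_some.comp (hf.comp .snd)) (.const none)
  refine ⟨fun x => Nat.rfindOpt (step x), Partrec.rfindOpt hstep, ?_⟩
  rintro x ⟨y, hy⟩
  have hdom : (Nat.rfindOpt (step x)).Dom :=
    Nat.rfindOpt_dom.2 ⟨Encodable.encode y, f y, by simp [step, hy]⟩
  have hmem := Part.get_mem hdom
  obtain ⟨k, hk⟩ := Nat.rfindOpt_spec hmem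
  simp only [step, Option.mem_def, Option.bind_eq_some_iff] at hk
  obtain ⟨z, -, hz⟩ := hk
  split_ifs at hz with h
  exact ⟨z, h, by rw [Option.some.inj hz]; exact hmem⟩

end Computability

end PureMorphic

/-! ### The main theorem -/

theorem mainTheorem2 :
    ∃ compute : List (List ℕ) × ℕ →. List (List ℕ) × ℕ × List (List ℕ),
      Partrec compute ∧
      ∀ (n : ℕ) (φ : FreeMonoid (Fin n) →* FreeMonoid (Fin n)) (a : Fin n) (α : ℕ → Fin n),
        PureMorphic.IsPureMorphic φ a α →
        ¬ PureMorphic.IsGrowing φ →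
        PureMorphic.BoundedFactorsBounded φ α →
        ∃ (m : ℕ) (σ : FreeMonoid (Fin m) →* FreeMonoid (Fin m)) (b : Fin m)
          (ψ : FreeMonoid (Fin m) →* FreeMonoid (Fin n)) (β : ℕ → Fin m),
          (PureMorphic.code σ, (b : ℕ), PureMorphic.code ψ) ∈
            compute (PureMorphic.code φ, (a : ℕ)) ∧
          PureMorphic.IsGrowing σ ∧
          PureMorphic.IsNonErasing ψ ∧
          PureMorphic.IsPureMorphic σ b β ∧
          PureMorphic.IsImage ψ β α ∧
          PureMorphic.SameComplexityClass α β := by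
  obtain ⟨compute, hcompute, hmem⟩ :=
    PureMorphic.exists_partrec_search PureMorphic.primrecPred_isValid Primrec.fst
  refine ⟨compute, hcompute, fun n φ a α hα _ hB => ?_⟩
  have hpow : ∀ p : ℕ, ∃ Φ : FreeMonoid (Fin n) →* FreeMonoid (Fin n), ∀ w, Φ w = φ^[p] w :=
    fun p => ⟨((show Monoid.End (FreeMonoid (Fin n)) from φ) ^ p : Monoid.End (FreeMonoid (Fin n))),
      fun w => congrFun (Monoid.End.coe_pow _ _ _) w⟩
  obtain ⟨p, hp⟩ := PureMorphic.exists_isCertificate hα hB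
  obtain ⟨Φ, hΦ⟩ := hpow p
  obtain ⟨m, σ, b, π, t, T, hcert⟩ := hp Φ hΦ
  -- The constructed certificate only guarantees that the search halts; the one found may have
  -- another exponent and alphabet, and its validity is enough.
  obtain ⟨y, hy, hycompute⟩ := hmem _ (hcert.exists_isValid hΦ)
  obtain ⟨Φ', hΦ'⟩ := hpow y.2.1
  obtain ⟨m, σ, b, π, t, T, hcert, hcode⟩ := hy.exists_isCertificate hΦ'
  obtain ⟨hσ, β, hβ, himage, hcomplexity⟩ := hcert.sound hα.apply_zero fun w hw => by
    rw [hΦ']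
    exact hα.isPrefixOf_iterate _ hw
  exact ⟨m, σ, b, FreeMonoid.map π, β, hcode ▸ hycompute, hσ, fun x => by simp, hβ, himage,
    hcomplexity⟩
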